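/- Let $k$ be a field and $Q$ a finite acyclic quiver. Let $\tilde Q$ be the framed quiver, obtained from $Q$ by adding a vertex $i'$ and an arrow $i\to i'$ for each vertex $i$ of $Q$. Let $\mathbb{Z}\tilde Q$ be its repetition quiver: its vertices are the pairs $(a,p)$ with $a\in\tilde Q_0$, $p\in\mathbb{Z}$, and for each arrow $\alpha:a\to b$ of $\tilde Q$ and each $p\in\mathbb{Z}$ it has arrows $(\alpha,p):(a,p)\to(b,p)$ and $\sigma(\alpha,p):(b,p-1)\to(a,p)$. Put $\sigma(\sigma(\alpha,p))=(\alpha,p-1)$. The vertices $(i',p)$, $i \in Q_0$, are called frozen. The regular Nakajima category $\mathcal{R}$ is the $k$-linear path category of $\mathbb{Z}\tilde Q$ modulo the mesh relations $\sum_{\beta:y\to x}\beta\,\sigma(\beta)=0$ for all non-frozen vertices $x$, where $\beta$ runs through the arrows with target $x$. Let $C$ be a set of vertices of $\mathbb{Z}Q$, and put $\sigma^{-1}(C)=\{(i',p) : (i,p)\in C\}$. Let $\mathcal{R}_C$ be the quotient of $\mathcal{R}$ by the ideal generated by the identities of the frozen vertices not in $\sigma^{-1}(C)$, and let $\mathcal{S}_C\subset\mathcal{R}_C$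 be the full subcategory on the vertices in $\sigma^{-1}(C)$. Modules are $k$-linear functors $\mathcal{R}_C^{op}\to\operatorname{Mod} k$, respectively $\mathcal{S}_C^{op}\to\operatorname{Mod} k$. Let $\operatorname{res}$ be the restriction functor from $\mathcal{R}_C$-modules to $\mathcal{S}_C$-modules, let $K_L$ and $K_R$ be its left and right adjoints (the Kan extensions), and let the intermediate extension $K_{LR}(M)$ be the image of the canonical morphism $K_L(M)\to K_R(M)$. We identify $\operatorname{res}K_{LR}(M)$ with $M$ via the canonical isomorphism, and $K_{LR}(U)$ with a submodule of $K_{LR}(M)$ for each submodule $U\subset M$. For a module $N$ and an integer-valued function $e$ on the objects, let $\operatorname{Gr}_e(N)$ be the quiver Grassmannian of submodules of $N$ of dimension vector $e$. Its points with values in a commutative $k$-algebra $A$ are the families, stable under all morphisms of the category, of finitely generated direct summands of the $A$-modules $A\otimes_k N(x)$ of constant rank $e(x)$; in particular $\operatorname{Gr}_e(N)$ is empty if $e$ has a negative value. For $v$ a function from the non-frozen vertices to $\mathbb{N}$ and $w$ a function from $\sigma^{-1}(C)$ to $\mathbb{N}$, let $(v,w)$ be the resulting function on the objects of $\mathcal{R}_C$,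 extended by $0$ to the frozen vertices not in $\sigma^{-1}(C)$. Let $$\pi_{v,w}:\operatorname{Gr}_{(v,w)}(K_{LR}M)\to\operatorname{Gr}_w(M),\qquad V\mapsto\operatorname{res}(V).$$ **Theorem.** Let $M$ be a finite-dimensional $\mathcal{S}_C$-module and $U\subset M$ a submodule of dimension vector $w$. Then: 1. All spaces $K_{LR}(M)(x)$ are finite-dimensional (so that the dimension vectors below make sense). 2. If $V\subset K_{LR}(M)$ is a submodule of dimension vector $(v,w)$, then $\operatorname{res}(V)=U$ if and only if $K_{LR}(U)\subset V$. 3. The fibre of $\pi_{v,w}$ over $U$ is isomorphic, as a functor of points on commutative $k$-algebras (hence as a scheme over $k$), to the quiver Grassmannian $$\operatorname{Gr}_{(v,w)-\underline{\dim}\,K_{LR}(U)}\bigl(K_{LR}(M)/K_{LR}(U)\bigr).$$ -/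

import Mathlib

open CategoryTheory Opposite TensorProduct

universe u

set_option linter.unusedSectionVars false

noncomputable section

namespace Nakajima

/-! ### Quotient of a `k`-linear category by the ideal generated by a class of morphisms -/

section LinearQuotient

variable (k : Type u) [Field k] {C : Type u} [Category.{u} C] [Preadditive C] [Linear k C]

/-- The morphisms `a ⟶ b` in the two-sided ideal generated by `W`: the `k`-linear span of all
composites `p ≫ r ≫ q` with `r` in `W`. -/
def idealSpan (W : MorphismProperty C) (a b : C) : Submodule k (a ⟶ b) :=
  Submodule.span k {f | ∃ (c d : C) (p : a ⟶ c) (r : c ⟶ d) (q : d ⟶ b), W r ∧ f = p ≫ r ≫ q}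

/-- Two morphisms are identified when their difference lies in the ideal generated by `W`. -/
def idealRel (W : MorphismProperty C) : HomRel C := fun a b f g => f - g ∈ idealSpan k W a b

variable {k} in
lemma idealSpan_comp_left {W : MorphismProperty C} {a b c : C} (h : a ⟶ b) {f : b ⟶ c}
    (hf : f ∈ idealSpan k W b c) : h ≫ f ∈ idealSpan k W a c := by
  have : idealSpan k W b c ≤ (idealSpan k W a c).comap (Linear.leftComp k c h) := by
    refine Submodule.span_le.2 ?_
    rintro _ ⟨d, e, p, r, q, hr, rfl⟩
    exact Submodule.subset_span ⟨d, e, h ≫ p, r, q, hr, by simp⟩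
  exact this hf

variable {k} in
lemma idealSpan_comp_right {W : MorphismProperty C} {a b c : C} {f : a ⟶ b} (h : b ⟶ c)
    (hf : f ∈ idealSpan k W a b) : f ≫ h ∈ idealSpan k W a c := by
  have : idealSpan k W a b ≤ (idealSpan k W a c).comap (Linear.rightComp k a h) := by
    refine Submodule.span_le.2 ?_
    rintro _ ⟨d, e, p, r, q, hr, rfl⟩
    exact Submodule.subset_span ⟨d, e, p, r, q ≫ h, hr, by simp⟩
  exact this hf

instance (W : MorphismProperty C) : Congruence (idealRel k W) where
  equivalence :=
    { refl := fun f => by simp [idealRel]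
      symm := fun {f g} h => by
        have := (idealSpan k W _ _).neg_mem h
        simpa [idealRel] using this
      trans := fun {f g h} h₁ h₂ => by
        have := (idealSpan k W _ _).add_mem h₁ h₂
        simpa [idealRel] using this }
  comp_left := fun h f g hfg => by
    have := idealSpan_comp_left h hfg
    simpa [idealRel] using this
  comp_right := fun h hfg => by
    have := idealSpan_comp_right h hfg
    simpa [idealRel] using this

/-- The quotient of the `k`-linear category `C` by the ideal generated by `W`. -/
abbrev LinearQuotient (W : MorphismProperty C) : Type u := Quotient (idealRel k W)

instance (W : MorphismProperty C) : Preadditive (LinearQuotient k W) :=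
  Quotient.preadditive _ fun X Y f₁ f₂ g₁ g₂ h₁ h₂ => by
    have := (idealSpan k W _ _).add_mem h₁ h₂
    simpa [idealRel, add_sub_add_comm] using this

instance (W : MorphismProperty C) : (Quotient.functor (idealRel k W)).Additive where
  map_add := rfl

instance (W : MorphismProperty C) : Linear k (LinearQuotient k W) :=
  Quotient.linear k _ fun a X Y f₁ f₂ h => by
    have := (idealSpan k W _ _).smul_mem a h
    simpa [idealRel, smul_sub] using this

end LinearQuotient

/-! ### Repetition quivers -/

/-- The vertices `(i, p)` of the repetition quiver. -/
@[ext] structure Repetition (V : Type u) : Type u where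
  vertex : V
  level : ℤ

/-- The arrows of the repetition quiver: `(α, p) : (i, p) → (j, p)` and
`σ(α, p) : (j, p - 1) → (i, p)` for each arrow `α : i → j` and each integer `p`. -/
inductive Repetition.Hom {V : Type u} [Quiver.{u} V] : Repetition V → Repetition V → Type u
  | level {i j : V} (α : i ⟶ j) (p : ℤ) : Hom ⟨i, p⟩ ⟨j, p⟩
  | sigma {i j : V} (α : i ⟶ j) (p : ℤ) : Hom ⟨j, p - 1⟩ ⟨i, p⟩

instance {V : Type u} [Quiver.{u} V] : Quiver.{u} (Repetition V) := ⟨Repetition.Hom⟩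

/-- The vertices of the framed quiver: `base i` is `i` and `frozen i` is the new vertex `i'`. -/
inductive Framed (V : Type u) : Type u
  | base (i : V) : Framed V
  | frozen (i : V) : Framed V

/-- The arrows of the framed quiver: those of the quiver and one arrow `i → i'` for each `i`. -/
inductive Framed.Hom {V : Type u} [Quiver.{u} V] : Framed V → Framed V → Type u
  | arrow {i j : V} (α : i ⟶ j) : Hom (.base i) (.base j)
  | frame (i : V) : Hom (.base i) (.frozen i)

instance {V : Type u} [Quiver.{u} V] : Quiver.{u} (Framed V) := ⟨Framed.Hom⟩

/-- A quiver is acyclic if it has no oriented cycles. -/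
def IsAcyclicQuiver (V : Type u) [Quiver.{u} V] : Prop :=
  ∀ (i : V) (p : Quiver.Path i i), p = Quiver.Path.nil

/-! ### The Nakajima categories -/

section Categories

variable (k : Type u) [Field k] (V : Type u) [Quiver.{u} V]

/-- The `k`-linear path category of the repetition quiver of the framed quiver. -/
abbrev PathCat : Type u := Free k (Paths (Repetition (Framed V)))

variable {V}

/-- A path, regarded as a morphism of the `k`-linear path category. -/
def pathHom {x y : Repetition (Framed V)} (p : Quiver.Path x y) :
    (Free.of k (x : Paths (Repetition (Framed V))) : PathCat k V) ⟶
      Free.of k (y : Paths (Repetition (Framed V))) :=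
  (Free.embedding k (Paths (Repetition (Framed V)))).map p

/-- The mesh relator at the non-frozen vertex `x = (i, p)`: the sum over all arrows `β : y → x`
of the paths `τ(x) → y → x` of length two formed by `σ(β)` and `β`. The arrows ending at `x` are
`(α, p)` for `α : h → i`, and `σ(α, p)` for `α : i → j`, and `σ(σ(α, p)) = (α, p - 1)`. -/
def mesh (i : V) (p : ℤ) :
    (Free.of k (⟨.base i, p - 1⟩ : Repetition (Framed V)) : PathCat k V) ⟶
      Free.of k (⟨.base i, p⟩ : Repetition (Framed V)) :=
  (∑ᶠ a : Σ h : Framed V, (h ⟶ Framed.base i), pathHom k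
      ((Quiver.Path.nil.cons (Repetition.Hom.sigma a.2 p)).cons (Repetition.Hom.level a.2 p))) +
  ∑ᶠ a : Σ j : Framed V, (Framed.base i ⟶ j), pathHom k
      ((Quiver.Path.nil.cons (Repetition.Hom.level a.2 (p - 1))).cons
        (Repetition.Hom.sigma a.2 p))

variable (V) in
/-- The mesh relators at the non-frozen vertices. -/
inductive MeshRelator : MorphismProperty (PathCat k V)
  | mk (i : V) (p : ℤ) : MeshRelator (mesh k i p)

variable (V) in
/-- The regular Nakajima category `R`: the mesh category of the repetition quiver of the framed
quiver, with mesh relations imposed at the non-frozen vertices only. -/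
abbrev RegularNakajima : Type u := LinearQuotient k (MeshRelator k V)

/-- The vertex underlying an object of the regular Nakajima category. -/
def RegularNakajima.vert (x : RegularNakajima k V) : Repetition (Framed V) := x.as

/-- The vertices `σ⁻¹(c)`, `c ∈ C`, that is, the `(i', p)` with `(i, p) ∈ C`. -/
def InSigmaInv (C : Set (Repetition V)) : Repetition (Framed V) → Prop
  | ⟨.base _, _⟩ => False
  | ⟨.frozen i, p⟩ => ⟨i, p⟩ ∈ C

/-- The identities of the frozen vertices not belonging to `σ⁻¹(C)`. -/
inductive OutsideIdentity (C : Set (Repetition V)) : MorphismProperty (RegularNakajima k V)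
  | mk (x : RegularNakajima k V) (i : V) (p : ℤ) (hx : x.vert = ⟨.frozen i, p⟩)
      (hC : ¬ InSigmaInv C x.vert) : OutsideIdentity C (𝟙 x)

/-- The category `R_C`: the quotient of the regular Nakajima category by the ideal generated by
the identities of the frozen vertices not belonging to `σ⁻¹(C)`. -/
abbrev RC (C : Set (Repetition V)) : Type u := LinearQuotient k (OutsideIdentity k C)

/-- The vertex underlying an object of `R_C`. -/
def RC.vert {C : Set (Repetition V)} (x : RC k C) : Repetition (Framed V) := x.as.vert

/-- The objects of `R_C` that are vertices in `σ⁻¹(C)`. -/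
def isSC (C : Set (Repetition V)) : ObjectProperty (RC k C) := fun x => InSigmaInv C x.vert

/-- The category `S_C`: the full subcategory of `R_C` formed by the vertices in `σ⁻¹(C)`. -/
abbrev SC (C : Set (Repetition V)) : Type u := (isSC k C).FullSubcategory

/-- The inclusion `S_C ⥤ R_C`. -/
abbrev inclSC (C : Set (Repetition V)) : SC k C ⥤ RC k C := (isSC k C).ι

/-- The dimension vector `(v, w)`: `v` on the non-frozen vertices `(i, p)` (indexed by the vertices
of the repetition quiver of `V`), `w` on the objects of `S_C`, and `0` on the frozen vertices
outside `σ⁻¹(C)`, which are zero objects of `R_C`. -/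
def dimVec {C : Set (Repetition V)} (v : Repetition V → ℕ) (w : SC k C → ℕ) (x : RC k C) : ℕ :=
  open Classical in
  match x.vert with
  | ⟨.base i, p⟩ => v ⟨i, p⟩
  | ⟨.frozen _, _⟩ => if h : isSC k C x then w ⟨x, h⟩ else 0

lemma dimVec_incl {C : Set (Repetition V)} (v : Repetition V → ℕ) (w : SC k C → ℕ) (s : SC k C) :
    dimVec k v w ((inclSC k C).obj s) = w s := by
  obtain ⟨x, h⟩ := s
  have h' : InSigmaInv C x.vert := h
  unfold dimVec
  simp only [ObjectProperty.ι_obj]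
  split
  · next i p hx => rw [hx] at h'; exact h'.elim
  · rw [dif_pos h]

end Categories

/-! ### Modules over a `k`-linear category -/

section Modules

variable {k : Type u} [Field k] {R : Type u} [Category.{u} R] [Preadditive R] [Linear k R]

/-- A functor `Rᵒᵖ ⥤ Mod k` is a (right) `R`-module if it is `k`-linear on morphism spaces. -/
class IsLinearModule (F : Rᵒᵖ ⥤ ModuleCat.{u} k) : Prop where
  map_add {x y : R} (f g : x ⟶ y) : F.map (f + g).op = F.map f.op + F.map g.op
  map_smul {x y : R} (c : k) (f : x ⟶ y) : F.map (c • f).op = c • F.map f.op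

/-- An `R`-module is finite-dimensional if its values are finite-dimensional and all but finitely
many of them vanish. -/
def IsFiniteDimensional (F : Rᵒᵖ ⥤ ModuleCat.{u} k) : Prop :=
  (∀ x : R, Module.Finite k (F.obj (op x))) ∧ {x : R | Nontrivial (F.obj (op x))}.Finite

/-- The value at `x` of the dimension vector of an `R`-module. -/
def dimVector (F : Rᵒᵖ ⥤ ModuleCat.{u} k) (x : R) : ℕ := Module.finrank k (F.obj (op x))

/-- A submodule of an `R`-module. -/
@[ext] structure SubMod (F : Rᵒᵖ ⥤ ModuleCat.{u} k) where
  obj (x : R) : Submodule k (F.obj (op x))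
  map_mem {x y : R} (f : x ⟶ y) {m : F.obj (op y)} : m ∈ obj y → (F.map f.op).hom m ∈ obj x

namespace SubMod

variable {F G : Rᵒᵖ ⥤ ModuleCat.{u} k}

instance : PartialOrder (SubMod F) := PartialOrder.lift SubMod.obj fun _ _ h => SubMod.ext h

/-- A submodule, regarded as a module. -/
def toModule (U : SubMod F) : Rᵒᵖ ⥤ ModuleCat.{u} k where
  obj x := ModuleCat.of k (U.obj x.unop)
  map {x y} f := ModuleCat.ofHom ((F.map f).hom.restrict fun _ h => U.map_mem f.unop h)
  map_id x := by ext m; simp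
  map_comp f g := by ext m; simp

/-- The inclusion of a submodule. -/
def incl (U : SubMod F) : U.toModule ⟶ F where
  app x := ModuleCat.ofHom (U.obj x.unop).subtype
  naturality _ _ f := by ext m; rfl

instance [IsLinearModule F] (U : SubMod F) : IsLinearModule U.toModule where
  map_add f g := by
    ext m; apply Subtype.ext
    exact congr($(IsLinearModule.map_add (F := F) f g).hom m.1)
  map_smul c f := by
    ext m; apply Subtype.ext
    exact congr($(IsLinearModule.map_smul (F := F) c f).hom m.1)

/-- The quotient of a module by a submodule. -/
def quotient (U : SubMod F) : Rᵒᵖ ⥤ ModuleCat.{u} k where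
  obj x := ModuleCat.of k (F.obj x ⧸ U.obj x.unop)
  map {x y} f := ModuleCat.ofHom
    ((U.obj x.unop).mapQ (U.obj y.unop) (F.map f).hom fun _ h => U.map_mem f.unop h)
  map_id x := by ext m; simp
  map_comp f g := by ext m; simp

/-- The image of a morphism of modules. -/
def range (η : F ⟶ G) : SubMod G where
  obj x := LinearMap.range (η.app (op x)).hom
  map_mem f := by
    rintro _ ⟨m, rfl⟩
    exact ⟨(F.map f.op).hom m, congr($(η.naturality f.op).hom m)⟩

/-- The image of a submodule under a morphism of modules. -/
def map (η : F ⟶ G) (U : SubMod F) : SubMod G where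
  obj x := (U.obj x).map (η.app (op x)).hom
  map_mem f := by
    rintro _ ⟨m, hm, rfl⟩
    exact ⟨(F.map f.op).hom m, U.map_mem f hm, congr($(η.naturality f.op).hom m)⟩

/-- The restriction of a submodule along a functor. -/
def restrict {S : Type u} [Category.{u} S] [Preadditive S] [Linear k S] (ι : S ⥤ R)
    (U : SubMod F) : SubMod (ι.op ⋙ F) where
  obj s := U.obj (ι.obj s)
  map_mem f _ h := U.map_mem (ι.map f) h

end SubMod

end Modules

/-! ### Kan extensions along a fully faithful `k`-linear functor `ι : S ⥤ R` -/

section Kan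

variable {k : Type u} [Field k] {R : Type u} [Category.{u} R] [Preadditive R] [Linear k R]
  {S : Type u} [Category.{u} S] [Preadditive S] [Linear k S]
  (ι : S ⥤ R) [ι.Additive] [ι.Linear k] [ι.Full] [ι.Faithful]

/-- The value at `x` of the right Kan extension: the space of natural transformations from
`R(ι -, x)` to `M`. -/
def KRObj (M : Sᵒᵖ ⥤ ModuleCat.{u} k) (x : R) :
    Submodule k (∀ s : S, (ι.obj s ⟶ x) →ₗ[k] M.obj (op s)) where
  carrier := {φ | ∀ (s t : S) (h : s ⟶ t) (f : ι.obj t ⟶ x),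
    φ s (ι.map h ≫ f) = (M.map h.op).hom (φ t f)}
  add_mem' hφ hψ s t h f := by simp [hφ s t h f, hψ s t h f]
  zero_mem' s t h f := by simp
  smul_mem' c φ hφ s t h f := by simp [hφ s t h f]

/-- The right Kan extension `K_R M` along `ι`, right adjoint to restriction. -/
def KR (M : Sᵒᵖ ⥤ ModuleCat.{u} k) : Rᵒᵖ ⥤ ModuleCat.{u} k where
  obj x := ModuleCat.of k (KRObj ι M x.unop)
  map {x y} g := ModuleCat.ofHom
    { toFun := fun φ => ⟨fun s => φ.1 s ∘ₗ Linear.rightComp k (ι.obj s) g.unop, fun s t h f => by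
        have := φ.2 s t h (f ≫ g.unop)
        simpa using this⟩
      map_add' := fun φ ψ => rfl
      map_smul' := fun c φ => rfl }
  map_id x := by
    ext φ s f
    simp
  map_comp f g := by
    ext φ s f
    simp

/-- Functoriality of the right Kan extension, at `x`. -/
def KRMapAux {M N : Sᵒᵖ ⥤ ModuleCat.{u} k} (η : M ⟶ N) (x : R) : KRObj ι M x →ₗ[k] KRObj ι N x where
  toFun φ := ⟨fun s => (η.app (op s)).hom ∘ₗ φ.1 s, fun s t h f => by
    have := φ.2 s t h f
    simp only [LinearMap.comp_apply, this]
    exact congr($(η.naturality h.op).hom (φ.1 t f))⟩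
  map_add' φ ψ := by
    apply Subtype.ext; funext s; exact LinearMap.comp_add _ _ _
  map_smul' c φ := by
    apply Subtype.ext; funext s; exact LinearMap.comp_smul _ _ _

/-- Functoriality of the right Kan extension. -/
def KRMap {M N : Sᵒᵖ ⥤ ModuleCat.{u} k} (η : M ⟶ N) : KR ι M ⟶ KR ι N where
  app x := ModuleCat.ofHom (KRMapAux ι η x.unop)
  naturality _ _ g := by ext φ; rfl

open Classical in
/-- The direct sum over `s` of the spaces `R(x, ι s) ⊗ M(s)`. -/
abbrev KLSum (M : Sᵒᵖ ⥤ ModuleCat.{u} k) (x : R) : Type u :=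
  DirectSum S fun s => (x ⟶ ι.obj s) ⊗[k] M.obj (op s)

open Classical in
/-- The element `f ⊗ m` of the summand at `s`. -/
def KLSum.mk (M : Sᵒᵖ ⥤ ModuleCat.{u} k) (x : R) (s : S) (f : x ⟶ ι.obj s) (m : M.obj (op s)) :
    KLSum ι M x :=
  DirectSum.lof k S (fun s => (x ⟶ ι.obj s) ⊗[k] M.obj (op s)) s (f ⊗ₜ m)

/-- The relations `(f ≫ ι h) ⊗ m = f ⊗ (m h)` defining the left Kan extension. -/
def KLRel (M : Sᵒᵖ ⥤ ModuleCat.{u} k) (x : R) : Submodule k (KLSum ι M x) :=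
  Submodule.span k {z | ∃ (s t : S) (h : s ⟶ t) (f : x ⟶ ι.obj s) (m : M.obj (op t)),
    z = KLSum.mk ι M x t (f ≫ ι.map h) m - KLSum.mk ι M x s f ((M.map h.op).hom m)}

open Classical in
/-- Precomposition `R(y, ι s) ⊗ M(s) → R(x, ι s) ⊗ M(s)` on the direct sums. -/
def KLSum.precomp (M : Sᵒᵖ ⥤ ModuleCat.{u} k) {x y : R} (g : x ⟶ y) :
    KLSum ι M y →ₗ[k] KLSum ι M x :=
  DirectSum.toModule k S _ fun s =>
    DirectSum.lof k S (fun s => (x ⟶ ι.obj s) ⊗[k] M.obj (op s)) s ∘ₗ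
      (Linear.leftComp k (ι.obj s) g).rTensor (M.obj (op s))

lemma KLSum.precomp_mk (M : Sᵒᵖ ⥤ ModuleCat.{u} k) {x y : R} (g : x ⟶ y) (s : S)
    (f : y ⟶ ι.obj s) (m : M.obj (op s)) :
    KLSum.precomp ι M g (KLSum.mk ι M y s f m) = KLSum.mk ι M x s (g ≫ f) m := by
  classical
  simp [KLSum.precomp, KLSum.mk]

lemma KLSum.hom_ext {M : Sᵒᵖ ⥤ ModuleCat.{u} k} {x : R} {N : Type*} [AddCommGroup N] [Module k N]
    {p q : KLSum ι M x →ₗ[k] N}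
    (h : ∀ s f m, p (KLSum.mk ι M x s f m) = q (KLSum.mk ι M x s f m)) : p = q := by
  classical
  refine DirectSum.linearMap_ext k fun s => TensorProduct.ext' fun f m => ?_
  exact h s f m

lemma KLRel_le_comap (M : Sᵒᵖ ⥤ ModuleCat.{u} k) {x y : R} (g : x ⟶ y) :
    KLRel ι M y ≤ (KLRel ι M x).comap (KLSum.precomp ι M g) := by
  refine Submodule.span_le.2 ?_
  rintro _ ⟨s, t, h, f, m, rfl⟩
  refine Submodule.subset_span ⟨s, t, h, g ≫ f, m, ?_⟩
  simp only [map_sub, KLSum.precomp_mk, Category.assoc]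

/-- The left Kan extension `K_L M` along `ι`, left adjoint to restriction: the coend
`(K_L M)(x) = R(x, ι -) ⊗_S M`. -/
def KL (M : Sᵒᵖ ⥤ ModuleCat.{u} k) : Rᵒᵖ ⥤ ModuleCat.{u} k where
  obj x := ModuleCat.of k (KLSum ι M x.unop ⧸ KLRel ι M x.unop)
  map {x y} g := ModuleCat.ofHom
    ((KLRel ι M x.unop).mapQ (KLRel ι M y.unop) (KLSum.precomp ι M g.unop)
      (KLRel_le_comap ι M g.unop))
  map_id x := by
    apply ModuleCat.hom_ext
    refine Submodule.linearMap_qext _ (KLSum.hom_ext ι fun s f m => ?_)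
    simp [KLSum.precomp_mk]
  map_comp g h := by
    apply ModuleCat.hom_ext
    refine Submodule.linearMap_qext _ (KLSum.hom_ext ι fun s f m => ?_)
    simp [KLSum.precomp_mk]

/-- The linear map `R(x, ι s) ⊗ M(s) → (K_R M)(x)` taking `f ⊗ m` to the natural transformation
`g ↦ m (g ≫ f)`, where `g ≫ f : ι t ⟶ ι s` is regarded as a morphism of `S`. -/
def canAux (M : Sᵒᵖ ⥤ ModuleCat.{u} k) [IsLinearModule M] (x : R) (s : S) :
    (x ⟶ ι.obj s) ⊗[k] M.obj (op s) →ₗ[k] KRObj ι M x :=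
  TensorProduct.lift <| LinearMap.mk₂ k
    (fun f m => (⟨fun t =>
      { toFun := fun g => (M.map (ι.preimage (g ≫ f)).op).hom m
        map_add' := fun g g' => by
          have : ι.preimage ((g + g') ≫ f) = ι.preimage (g ≫ f) + ι.preimage (g' ≫ f) :=
            ι.map_injective (by simp)
          rw [this, IsLinearModule.map_add]; rfl
        map_smul' := fun c g => by
          have : ι.preimage ((c • g) ≫ f) = c • ι.preimage (g ≫ f) :=
            ι.map_injective (by simp)
          rw [this, IsLinearModule.map_smul]; rfl }, fun t t' h g => by
        have : ι.preimage ((ι.map h ≫ g) ≫ f) = h ≫ ι.preimage (g ≫ f) :=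
          ι.map_injective (by simp)
        simp only [LinearMap.coe_mk, AddHom.coe_mk]
        rw [this, op_comp, M.map_comp]; rfl⟩ : KRObj ι M x))
    (fun f f' m => by
      apply Subtype.ext; funext t; ext g
      have : ι.preimage (g ≫ (f + f')) = ι.preimage (g ≫ f) + ι.preimage (g ≫ f') :=
        ι.map_injective (by simp)
      change (M.map (ι.preimage (g ≫ (f + f'))).op).hom m = _
      rw [this, IsLinearModule.map_add]; rfl)
    (fun c f m => by
      apply Subtype.ext; funext t; ext g
      have : ι.preimage (g ≫ (c • f)) = c • ι.preimage (g ≫ f) :=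
        ι.map_injective (by simp)
      change (M.map (ι.preimage (g ≫ (c • f))).op).hom m = _
      rw [this, IsLinearModule.map_smul]; rfl)
    (fun f m m' => by
      apply Subtype.ext; funext t; ext g
      exact map_add (M.map (ι.preimage (g ≫ f)).op).hom m m')
    (fun c f m => by
      apply Subtype.ext; funext t; ext g
      exact map_smul (M.map (ι.preimage (g ≫ f)).op).hom c m)

lemma canAux_apply (M : Sᵒᵖ ⥤ ModuleCat.{u} k) [IsLinearModule M] (x : R) (s : S)
    (f : x ⟶ ι.obj s) (m : M.obj (op s)) (t : S) (g : ι.obj t ⟶ x) :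
    (canAux ι M x s (f ⊗ₜ m)).1 t g = (M.map (ι.preimage (g ≫ f)).op).hom m := rfl

open Classical in
/-- The canonical map on the direct sums. -/
def canSum (M : Sᵒᵖ ⥤ ModuleCat.{u} k) [IsLinearModule M] (x : R) :
    KLSum ι M x →ₗ[k] KRObj ι M x :=
  DirectSum.toModule k S _ fun s => canAux ι M x s

lemma canSum_mk (M : Sᵒᵖ ⥤ ModuleCat.{u} k) [IsLinearModule M] (x : R) (s : S)
    (f : x ⟶ ι.obj s) (m : M.obj (op s)) :
    canSum ι M x (KLSum.mk ι M x s f m) = canAux ι M x s (f ⊗ₜ m) := by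
  classical
  simp [canSum, KLSum.mk]

lemma KLRel_le_ker (M : Sᵒᵖ ⥤ ModuleCat.{u} k) [IsLinearModule M] (x : R) :
    KLRel ι M x ≤ LinearMap.ker (canSum ι M x) := by
  refine Submodule.span_le.2 ?_
  rintro _ ⟨s, t, h, f, m, rfl⟩
  simp only [SetLike.mem_coe, LinearMap.mem_ker, map_sub, canSum_mk, sub_eq_zero]
  apply Subtype.ext; funext t'; ext g
  have : ι.preimage (g ≫ f ≫ ι.map h) = ι.preimage (g ≫ f) ≫ h := ι.map_injective (by simp)
  rw [canAux_apply, canAux_apply, this, op_comp, M.map_comp]; rfl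

/-- The canonical morphism `can : K_L M ⟶ K_R M`. -/
def can (M : Sᵒᵖ ⥤ ModuleCat.{u} k) [IsLinearModule M] : KL ι M ⟶ KR ι M where
  app x := ModuleCat.ofHom ((KLRel ι M x.unop).liftQ (canSum ι M x.unop) (KLRel_le_ker ι M x.unop))
  naturality x y g := by
    apply ModuleCat.hom_ext
    refine Submodule.linearMap_qext _ (KLSum.hom_ext ι fun s f m => ?_)
    change canSum ι M y.unop (KLSum.precomp ι M g.unop (KLSum.mk ι M x.unop s f m)) =
      ((KR ι M).map g).hom (canSum ι M x.unop (KLSum.mk ι M x.unop s f m))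
    rw [KLSum.precomp_mk, canSum_mk, canSum_mk]
    apply Subtype.ext; funext t; ext h
    change (canAux ι M y.unop s ((g.unop ≫ f) ⊗ₜ m)).1 t h =
      (canAux ι M x.unop s (f ⊗ₜ m)).1 t (h ≫ g.unop)
    rw [canAux_apply, canAux_apply, Category.assoc]

/-- The intermediate extension `K_LR M`: the image of `can : K_L M ⟶ K_R M`. -/
def KLR (M : Sᵒᵖ ⥤ ModuleCat.{u} k) [IsLinearModule M] : Rᵒᵖ ⥤ ModuleCat.{u} k :=
  (SubMod.range (can ι M)).toModule

lemma mem_range_can {M : Sᵒᵖ ⥤ ModuleCat.{u} k} [IsLinearModule M] {x : R} {φ : KRObj ι M x} :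
    φ ∈ (SubMod.range (can ι M)).obj x ↔ φ ∈ LinearMap.range (canSum ι M x) := by
  constructor
  · rintro ⟨z, rfl⟩
    obtain ⟨z, rfl⟩ := Submodule.Quotient.mk_surjective _ z
    exact ⟨z, rfl⟩
  · rintro ⟨z, rfl⟩
    exact ⟨Submodule.Quotient.mk z, rfl⟩

lemma KRMap_mem_range {M N : Sᵒᵖ ⥤ ModuleCat.{u} k} [IsLinearModule M] [IsLinearModule N]
    (η : M ⟶ N) (x : R) (φ : KRObj ι M x) (hφ : φ ∈ (SubMod.range (can ι M)).obj x) :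
    KRMapAux ι η x φ ∈ (SubMod.range (can ι N)).obj x := by
  rw [mem_range_can] at hφ ⊢
  obtain ⟨z, rfl⟩ := hφ
  have : (LinearMap.range (canSum ι N x)).mkQ ∘ₗ KRMapAux ι η x ∘ₗ canSum ι M x = 0 := by
    refine KLSum.hom_ext ι fun s f m => ?_
    simp only [LinearMap.comp_apply, LinearMap.zero_apply, Submodule.mkQ_apply,
      Submodule.Quotient.mk_eq_zero]
    refine ⟨KLSum.mk ι N x s f ((η.app (op s)).hom m), ?_⟩
    rw [canSum_mk, canSum_mk]
    apply Subtype.ext; funext t; ext g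
    exact (congr($(η.naturality (ι.preimage (g ≫ f)).op).hom m)).symm
  have := congr($this z)
  simpa using this

/-- Functoriality of the intermediate extension, induced by that of `K_R`. -/
def KLRMap {M N : Sᵒᵖ ⥤ ModuleCat.{u} k} [IsLinearModule M] [IsLinearModule N] (η : M ⟶ N) :
    KLR ι M ⟶ KLR ι N where
  app x := ModuleCat.ofHom ((KRMapAux ι η x.unop).restrict (KRMap_mem_range ι η x.unop))
  naturality x y g := by
    ext φ; apply Subtype.ext
    exact congr($((KRMap ι η).naturality g).hom φ.1)

/-- For a submodule `U ⊆ M`, the intermediate extension `K_LR U` as a submodule of `K_LR M`, via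
the (injective) map induced by the inclusion. -/
def KLRSub {M : Sᵒᵖ ⥤ ModuleCat.{u} k} [IsLinearModule M] (U : SubMod M) : SubMod (KLR ι M) :=
  SubMod.range (KLRMap ι U.incl)

/-- The map `K_LR U ⟶ K_LR M` is injective. -/
lemma KLRMap_incl_injective {M : Sᵒᵖ ⥤ ModuleCat.{u} k} [IsLinearModule M] (U : SubMod M) (x : R) :
    Function.Injective ((KLRMap ι U.incl).app (op x)).hom := by
  intro φ ψ h
  apply Subtype.ext; apply Subtype.ext; funext s; ext f
  apply Subtype.ext
  exact congr(($h).1.1 s f)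

/-- The canonical identification `(K_LR M)(ι s) ≃ M(s)`, evaluation at the identity of `ι s`
(the counit of the adjunction between restriction and `K_R`). -/
def KLREval (M : Sᵒᵖ ⥤ ModuleCat.{u} k) [IsLinearModule M] (s : S) :
    (KLR ι M).obj (op (ι.obj s)) ≃ₗ[k] M.obj (op s) :=
  LinearEquiv.ofBijective
    { toFun := fun φ => φ.1.1 s (𝟙 (ι.obj s))
      map_add' := fun _ _ => rfl
      map_smul' := fun _ _ => rfl } <| by
    constructor
    · intro φ ψ h
      apply Subtype.ext; apply Subtype.ext; funext t; ext g
      have h₁ := φ.1.2 t s (ι.preimage g) (𝟙 _)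
      have h₂ := ψ.1.2 t s (ι.preimage g) (𝟙 _)
      simp only [Functor.map_preimage, Category.comp_id] at h₁ h₂
      rw [h₁, h₂]
      exact congr((M.map (ι.preimage g).op).hom $h)
    · intro m
      refine ⟨⟨canAux ι M (ι.obj s) s (𝟙 _ ⊗ₜ m),
        Submodule.Quotient.mk (KLSum.mk ι M _ s (𝟙 _) m), canSum_mk ι M _ s _ m⟩, ?_⟩
      change (canAux ι M (ι.obj s) s (𝟙 _ ⊗ₜ m)).1 s (𝟙 _) = m
      rw [canAux_apply]
      simp

/-- The canonical isomorphism `res (K_LR M) ≅ M`. -/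
def resKLR (M : Sᵒᵖ ⥤ ModuleCat.{u} k) [IsLinearModule M] : ι.op ⋙ KLR ι M ≅ M :=
  NatIso.ofComponents (fun s => (KLREval ι M s.unop).toModuleIso) fun {s t} h => by
    ext φ
    change φ.1.1 t.unop (𝟙 _ ≫ ι.map h.unop) = (M.map h).hom (φ.1.1 s.unop (𝟙 _))
    have := φ.1.2 _ _ h.unop (𝟙 _)
    simpa using this

/-- The restriction `res V` of a submodule `V` of `K_LR M`, as a submodule of `M` via the canonical
isomorphism `res (K_LR M) ≅ M`. -/
def resSub {M : Sᵒᵖ ⥤ ModuleCat.{u} k} [IsLinearModule M] (W : SubMod (KLR ι M)) : SubMod M :=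
  (W.restrict ι).map (resKLR ι M).hom

end Kan

/-! ### Base change of families of subspaces -/

section BaseChange

variable {k : Type u} [Field k] {A B D : Type u} [CommRing A] [Algebra k A] [CommRing B]
  [Algebra k B] [CommRing D] [Algebra k D] {E E' : Type u} [AddCommGroup E] [Module k E]
  [AddCommGroup E'] [Module k E']

/-- The pull-back along `f : A → B` of an `A`-submodule `N` of `A ⊗ E`: the `B`-submodule of
`B ⊗ E` generated by the image of `N`. -/
def pullSub (f : A →ₐ[k] B) (N : Submodule A (A ⊗[k] E)) : Submodule B (B ⊗[k] E) :=
  Submodule.span B (f.toLinearMap.rTensor E '' N)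

/-- An `A`-submodule `N` of `A ⊗ E` is a subbundle of rank `r` if it is a finitely generated
direct summand, all of whose localizations at primes of `A` have rank `r`. -/
structure IsSubbundle (N : Submodule A (A ⊗[k] E)) (r : ℤ) : Prop where
  isComplemented : ∃ N' : Submodule A (A ⊗[k] E), IsCompl N N'
  finite : Module.Finite A N
  rank_eq (p : PrimeSpectrum A) : (Module.rankAtStalk (R := A) N p : ℤ) = r

lemma pullSub_id (N : Submodule A (A ⊗[k] E)) : pullSub (AlgHom.id k A) N = N := by
  have : (AlgHom.id k A).toLinearMap.rTensor E '' (N : Set (A ⊗[k] E)) = N := by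
    have h : (AlgHom.id k A).toLinearMap = LinearMap.id := rfl
    simp [h]
  rw [pullSub, this, Submodule.span_eq]

lemma rTensor_smul (f : A →ₐ[k] B) (a : A) (z : A ⊗[k] E) :
    f.toLinearMap.rTensor E (a • z) = f a • f.toLinearMap.rTensor E z := by
  induction z using TensorProduct.induction_on with
  | zero => simp
  | tmul b m => simp [TensorProduct.smul_tmul']
  | add z w hz hw => simp only [smul_add, map_add, hz, hw]

lemma pullSub_span (f : A →ₐ[k] B) (s : Set (A ⊗[k] E)) :
    pullSub f (Submodule.span A s) = Submodule.span B (f.toLinearMap.rTensor E '' s) := by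
  refine le_antisymm (Submodule.span_le.2 ?_) (Submodule.span_mono
    (Set.image_mono Submodule.subset_span))
  rintro _ ⟨z, hz, rfl⟩
  induction hz using Submodule.span_induction with
  | mem z hz => exact Submodule.subset_span ⟨z, hz, rfl⟩
  | zero => simp
  | add z w _ _ hz hw => rw [map_add]; exact add_mem hz hw
  | smul a z _ hz => rw [rTensor_smul]; exact Submodule.smul_mem _ _ hz

lemma pullSub_comp (f : A →ₐ[k] B) (g : B →ₐ[k] D) (N : Submodule A (A ⊗[k] E)) :
    pullSub (g.comp f) N = pullSub g (pullSub f N) := by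
  conv_rhs => rw [pullSub.eq_1 f, pullSub_span]
  rw [pullSub, Set.image_image]
  congr 1
  refine Set.image_congr fun z _ => ?_
  rw [← LinearMap.comp_apply, ← LinearMap.rTensor_comp]
  rfl

lemma rTensor_baseChange (f : A →ₐ[k] B) (l : E →ₗ[k] E') (z : A ⊗[k] E) :
    l.baseChange B (f.toLinearMap.rTensor E z) = f.toLinearMap.rTensor E' (l.baseChange A z) := by
  induction z using TensorProduct.induction_on with
  | zero => simp
  | tmul b m => simp
  | add z w hz hw => simp only [map_add, hz, hw]

lemma pullSub_map (f : A →ₐ[k] B) (l : E →ₗ[k] E') (N : Submodule A (A ⊗[k] E)) :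
    (pullSub f N).map (l.baseChange B) = pullSub f (N.map (l.baseChange A)) := by
  rw [pullSub, pullSub, Submodule.map_span, Submodule.map_coe, Set.image_image, Set.image_image]
  congr 1
  exact Set.image_congr fun z _ => rTensor_baseChange f l z

lemma IsSubbundle.pullSub {N : Submodule A (A ⊗[k] E)} {r : ℤ} (h : IsSubbundle N r)
    (f : A →ₐ[k] B) : IsSubbundle (pullSub f N) r := by
  obtain ⟨⟨N', hN'⟩, hfin, hrank⟩ := h
  let _ : Algebra A B := f.toAlgebra
  have : IsScalarTower k A B := IsScalarTower.of_algebraMap_eq' f.comp_algebraMap.symm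
  let c : B ⊗[A] (A ⊗[k] E) ≃ₗ[B] B ⊗[k] E := AlgebraTensorModule.cancelBaseChange k A B B E
  have hc : ∀ z : A ⊗[k] E, c (1 ⊗ₜ z) = f.toLinearMap.rTensor E z := by
    intro z
    induction z using TensorProduct.induction_on with
    | zero => simp
    | tmul b m =>
      simp only [c, AlgebraTensorModule.cancelBaseChange_tmul, LinearMap.rTensor_tmul,
        AlgHom.toLinearMap_apply, Algebra.smul_def, mul_one]
      rfl
    | add z w hz hw => rw [tmul_add, map_add, map_add, hz, hw]
  -- the projection onto `N`, and its base change
  let pr : A ⊗[k] E →ₗ[A] N := N.projectionOnto N' hN'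
  have hpr : pr ∘ₗ N.subtype = LinearMap.id :=
    LinearMap.ext fun x => Submodule.projectionOnto_apply_left hN' x
  let j : B ⊗[A] N →ₗ[B] B ⊗[k] E := c.toLinearMap ∘ₗ N.subtype.baseChange B
  let q : B ⊗[k] E →ₗ[B] B ⊗[A] N := pr.baseChange B ∘ₗ c.symm.toLinearMap
  have hqj : q ∘ₗ j = LinearMap.id := by
    apply LinearMap.ext; intro z
    simp only [q, j, LinearMap.comp_apply, LinearEquiv.coe_coe, LinearEquiv.symm_apply_apply]
    rw [← LinearMap.comp_apply, ← LinearMap.baseChange_comp, hpr]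
    simp
  have hinj : Function.Injective j :=
    Function.LeftInverse.injective (g := q) fun z => congr($hqj z)
  have hrange : LinearMap.range j = Nakajima.pullSub f N := by
    apply le_antisymm
    · rintro _ ⟨z, rfl⟩
      induction z using TensorProduct.induction_on with
      | zero => simp
      | tmul b n =>
        have : j (b ⊗ₜ n) = b • f.toLinearMap.rTensor E n.1 := by
          rw [← hc, ← map_smul]
          simp [j, TensorProduct.smul_tmul']
        rw [this]
        exact Submodule.smul_mem _ _ (Submodule.subset_span ⟨n.1, n.2, rfl⟩)
      | add z w hz hw => rw [map_add]; exact add_mem hz hw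
    · refine Submodule.span_le.2 ?_
      rintro _ ⟨z, hz, rfl⟩
      exact ⟨1 ⊗ₜ ⟨z, hz⟩, by simp [j, hc]⟩
  let e : B ⊗[A] N ≃ₗ[B] Nakajima.pullSub f N :=
    (LinearEquiv.ofInjective j hinj).trans (LinearEquiv.ofEq _ _ hrange)
  have : Module.Projective A N := Module.Projective.of_split N.subtype pr hpr
  have hker : IsCompl (Nakajima.pullSub f N) (LinearMap.ker (e.toLinearMap ∘ₗ q)) := by
    refine LinearMap.isCompl_of_proj fun x => ?_
    obtain ⟨z, rfl⟩ := e.surjective x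
    have hz : q (e z : B ⊗[k] E) = z := congr($hqj z)
    simp [hz]
  refine ⟨⟨_, hker⟩, Module.Finite.equiv e, fun p => ?_⟩
  have h₁ := congr_fun (Module.rankAtStalk_eq_of_equiv
    (M := B ⊗[A] N) (N := Nakajima.pullSub f N) e) p
  have h₂ := Module.rankAtStalk_baseChange (R := A) (M := N) (S := B) p
  have h₃ := hrank (PrimeSpectrum.comap (algebraMap A B) p)
  rw [← h₃, ← h₂]
  exact congr_arg _ h₁.symm

lemma IsSubbundle.map {N : Submodule A (A ⊗[k] E)} {r : ℤ} (h : IsSubbundle N r)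
    (l : E ≃ₗ[k] E') : IsSubbundle (N.map (l.toLinearMap.baseChange A)) r := by
  let e : A ⊗[k] E ≃ₗ[A] A ⊗[k] E' := l.baseChange k A E E'
  have he : N.map (l.toLinearMap.baseChange A) = N.map e.toLinearMap := rfl
  rw [he]
  obtain ⟨⟨N', hN'⟩, hfin, hrank⟩ := h
  have e' : N ≃ₗ[A] N.map e.toLinearMap := e.submoduleMap N
  refine ⟨⟨N'.map e.toLinearMap, (Submodule.orderIsoMapComap e).isCompl hN'⟩,
    Module.Finite.equiv e', fun p => ?_⟩
  have h₁ := congr_fun (Module.rankAtStalk_eq_of_equiv (M := N)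
    (N := N.map e.toLinearMap) e') p
  rw [← hrank p]
  exact congr_arg _ h₁.symm

lemma isSubbundle_baseChange (N : Submodule k E) [Module.Finite k N] :
    IsSubbundle (N.baseChange k) (Module.finrank k N) := by
  have hinj : Function.Injective (N.subtype.baseChange k) :=
    Module.Flat.lTensor_preserves_injective_linearMap (M := k) N.subtype N.injective_subtype
  have e : k ⊗[k] N ≃ₗ[k] N.baseChange k :=
    (LinearEquiv.ofInjective _ hinj).trans (LinearEquiv.ofEq _ _ rfl)
  have := Module.Finite.equiv e
  refine ⟨Submodule.exists_isCompl _, this, fun p => ?_⟩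
  have h₁ := congr_fun (Module.rankAtStalk_eq_of_equiv (M := k ⊗[k] N)
    (N := N.baseChange k) e) p
  rw [Module.rankAtStalk_eq_finrank_of_free] at h₁
  simp only [Pi.natCast_apply, Module.finrank_baseChange] at h₁
  exact congr_arg _ h₁.symm

end BaseChange

/-! ### Quiver Grassmannians -/

section Grassmannian

variable {k : Type u} [Field k] {R : Type u} [Category.{u} R]

/-- The `A`-points of the quiver Grassmannian `Gr_e(F)` of an `R`-module `F`, for a commutative
`k`-algebra `A`: the families of subbundles of `A ⊗ F(x)` of rank `e(x)` which are stable under the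
morphisms of `R`. A dimension vector `e` with a negative entry is allowed; it admits no
submodules. -/
@[ext] structure GrPoint (F : Rᵒᵖ ⥤ ModuleCat.{u} k) (e : R → ℤ) (A : Type u) [CommRing A]
    [Algebra k A] : Type u where
  obj (x : R) : Submodule A (A ⊗[k] F.obj (op x))
  map_mem {x y : R} (f : x ⟶ y) {m : A ⊗[k] F.obj (op y)} :
    m ∈ obj y → (F.map f.op).hom.baseChange A m ∈ obj x
  isSubbundle (x : R) : IsSubbundle (obj x) (e x)

/-- The quiver Grassmannian `Gr_e(F)`, given by its functor of points on commutative
`k`-algebras. -/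
def Gr (F : Rᵒᵖ ⥤ ModuleCat.{u} k) (e : R → ℤ) : CommAlgCat.{u} k ⥤ Type u where
  obj A := GrPoint F e A
  map {A B} f := ↾fun V =>
    { obj := fun x => pullSub f.hom (V.obj x)
      map_mem := fun {x y} g m hm => by
        have h := Submodule.mem_map_of_mem (f := (F.map g.op).hom.baseChange B) hm
        rw [pullSub_map] at h
        exact Submodule.span_mono (Set.image_mono
          (Submodule.map_le_iff_le_comap.2 fun _ => V.map_mem g)) h
      isSubbundle := fun x => (V.isSubbundle x).pullSub f.hom }
  map_id A := by
    apply ConcreteCategory.hom_ext; intro V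
    exact GrPoint.ext (funext fun x => pullSub_id (V.obj x))
  map_comp f g := by
    apply ConcreteCategory.hom_ext; intro V
    exact GrPoint.ext (funext fun x => pullSub_comp f.hom g.hom (V.obj x))

/-- A submodule `U` of `F` of dimension vector `e`, regarded as the `k`-point `k ⊗ U ⊆ k ⊗ F` of
`Gr_e(F)`. -/
def SubMod.toPoint {F : Rᵒᵖ ⥤ ModuleCat.{u} k} (U : SubMod F) {e : R → ℕ}
    (hF : IsFiniteDimensional F) (hU : ∀ x, Module.finrank k (U.obj x) = e x) :
    (Gr F fun x => (e x : ℤ)).obj (CommAlgCat.of k k) where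
  obj x := (U.obj x).baseChange k
  map_mem {x y} f m hm := by
    rw [Submodule.baseChange_eq_span] at hm
    induction hm using Submodule.span_induction with
    | mem z hz =>
      obtain ⟨u, hu, rfl⟩ := hz
      exact Submodule.tmul_mem_baseChange_of_mem 1 (U.map_mem f hu)
    | zero => simp
    | add z w _ _ hz hw => rw [map_add]; exact add_mem hz hw
    | smul a z _ hz => rw [map_smul]; exact Submodule.smul_mem _ _ hz
  isSubbundle x := by
    have := hF.1 x
    rw [← hU x]
    exact isSubbundle_baseChange _

/-- The fibre of a morphism of functors of points over a `k`-point `y`: its `A`-points are the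
`A`-points of the source mapped to the `A`-point of the target induced by `y`. -/
def fibre {X Y : CommAlgCat.{u} k ⥤ Type u} (π : X ⟶ Y) (y : Y.obj (CommAlgCat.of k k)) :
    CommAlgCat.{u} k ⥤ Type u where
  obj A := {x : X.obj A // π.app A x = Y.map (CommAlgCat.ofHom (Algebra.ofId k A)) y}
  map {A B} f := ↾fun x => ⟨X.map f x.1, by
    have h : CommAlgCat.ofHom (Algebra.ofId k A) ≫ f = CommAlgCat.ofHom (Algebra.ofId k B) := by
      ext
    rw [← h, Y.map_comp, CategoryTheory.comp_apply]
    exact (congr($(π.naturality f) x.1)).trans congr((Y.map f) $(x.2))⟩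
  map_id A := by ext x; simp
  map_comp f g := by ext x; simp

variable {S : Type u} [Category.{u} S] [Preadditive R] [Linear k R] [Preadditive S] [Linear k S]
  (ι : S ⥤ R) [ι.Additive] [ι.Linear k] [ι.Full] [ι.Faithful]

/-- The morphism `Gr_e(K_LR M) ⟶ Gr_d(M)`, where `d` is the restriction of `e`, taking a submodule
`V` of `K_LR M` to its restriction `res V`, regarded as a submodule of `M` via the canonical
isomorphism `res (K_LR M) ≅ M`. -/
def resGr (M : Sᵒᵖ ⥤ ModuleCat.{u} k) [IsLinearModule M] (e : R → ℤ) (d : S → ℤ)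
    (hd : ∀ s, e (ι.obj s) = d s) : Gr (KLR ι M) e ⟶ Gr M d where
  app A := ↾fun V =>
    { obj := fun s => (V.obj (ι.obj s)).map ((KLREval ι M s).toLinearMap.baseChange A)
      map_mem := fun {s t} h m hm => by
        obtain ⟨n, hn, rfl⟩ := hm
        refine ⟨((KLR ι M).map (ι.map h).op).hom.baseChange A n, V.map_mem (ι.map h) hn, ?_⟩
        have key : (KLREval ι M s).toLinearMap ∘ₗ ((KLR ι M).map (ι.map h).op).hom =
            (M.map h.op).hom ∘ₗ (KLREval ι M t).toLinearMap := by
          ext φ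
          exact congr($((resKLR ι M).hom.naturality h.op).hom φ)
        rw [← LinearMap.comp_apply, ← LinearMap.comp_apply, ← LinearMap.baseChange_comp, key,
          LinearMap.baseChange_comp]
      isSubbundle := fun s => hd s ▸ (V.isSubbundle (ι.obj s)).map (KLREval ι M s) }
  naturality A B f := by
    apply ConcreteCategory.hom_ext; intro V
    exact GrPoint.ext (funext fun s =>
      pullSub_map f.hom (KLREval ι M s).toLinearMap (V.obj (ι.obj s)))

end Grassmannian

end Nakajima

end

open Nakajima

noncomputable section

namespace Nakajima


/-! ### Finiteness of the morphism spaces of `R_C` -/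

/-! As an image of `K_L(U)`, the module `K_LR(U)` is generated by its values on `S_C`, that is, by
`U` (`KLRSub_obj_le`). Hence a submodule `V` of `K_LR(M)` contains `K_LR(U)` exactly when `res V`
contains `U` (`KLRSub_le_of_le_resSub`, `le_resSub_of_KLRSub_le`). If moreover `res V` has the
dimension vector of `U`, then containing `U` is the same as being equal to `U`. So the fibre over
`U` consists of the `V` containing `K_LR(U)`, and these are the submodules of `K_LR(M)/K_LR(U)`,
with the dimension vector of `K_LR(U)` subtracted.

For an isomorphism of functors the same argument is run on `A`-points (`map_KLREval_eq_iff`).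
Generation survives because `A ⊗ K_LR(U)` is spanned over `A` by the elements `1 ⊗ φ`. The
comparison of dimensions is replaced by two facts: subbundles containing a constant one `A ⊗ P`
correspond to subbundles of `A ⊗ (E / P)` of rank smaller by `dim P` (`isSubbundle_comap_iff`), and
a subbundle of rank zero vanishes (`IsSubbundle.eq_bot`). The first fact also gives the passage to
the quotient (`GrPoint.quotientEquiv`).

Finite-dimensionality holds because `K_LR(M)(x)` is spanned by the images of the spaces `R_C(x, s) ⊗
M(s)`, of which finitely many are nonzero. Morphism spaces of `R_C` are finite-dimensional since
acyclicity provides an integer height on the repetition quiver that increases along arrows, leaving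
finitely many paths between two vertices (`finite_path`). -/

/-- In a quiver with finitely many arrows into each vertex and an integer-valued function strictly
increasing along arrows, there are finitely many paths between any two vertices. -/
lemma finite_path_of_strictMono {W : Type*} [Quiver W] (φ : W → ℤ)
    (hφ : ∀ {x y : W}, (x ⟶ y) → φ x < φ y) [∀ y : W, Finite (Σ x : W, (x ⟶ y))] (x y : W) :
    Finite (Quiver.Path x y) := by
  have hpath : ∀ {y : W}, Quiver.Path x y → φ x ≤ φ y := by
    intro y p
    induction p with
    | nil => exact le_rfl
    | cons _ a ih => exact ih.trans (hφ a).le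
  -- Induction on a strict bound for the height gap: removing the last arrow lowers the gap by at
  -- least one, and a negative gap admits no path.
  suffices h : ∀ (n : ℕ) (y : W), φ y - φ x < (n : ℤ) → Finite (Quiver.Path x y) from
    h ((φ y - φ x).toNat + 1) y (by push_cast; omega)
  intro n
  induction n with
  | zero =>
    intro y hy
    have : IsEmpty (Quiver.Path x y) := ⟨fun p => by have := hpath p; push_cast at hy; omega⟩
    infer_instance
  | succ n ih =>
    intro y hy
    have (a : Σ z : W, (z ⟶ y)) : Finite (Quiver.Path x a.1) :=
      ih a.1 (by have := hφ a.2; push_cast at hy; omega)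
    refine Finite.of_surjective
      (α := PLift (x = y) ⊕ (Σ a : (Σ z : W, (z ⟶ y)), Quiver.Path x a.1))
      (Sum.elim (fun p => p.down ▸ Quiver.Path.nil) fun p => p.2.cons p.1.2) fun p => ?_
    cases p with
    | nil => exact ⟨.inl ⟨rfl⟩, rfl⟩
    | cons p a => exact ⟨.inr ⟨⟨_, a⟩, p⟩, rfl⟩

section Quiver

variable {V : Type u} [Quiver.{u} V]

/-- In a finite acyclic quiver, the number of vertices with a path to a given vertex strictly
increases along arrows. -/
lemma IsAcyclicQuiver.ncard_lt [Finite V] (hV : IsAcyclicQuiver V) {i j : V} (α : i ⟶ j) :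
    {h : V | Nonempty (Quiver.Path h i)}.ncard < {h : V | Nonempty (Quiver.Path h j)}.ncard := by
  refine Set.ncard_lt_ncard ⟨fun h ⟨p⟩ => ⟨p.cons α⟩, fun hle => ?_⟩ (Set.toFinite _)
  -- The inclusion is strict because of `j` itself: a path from `j` to `i` followed by `α` would be
  -- a cycle.
  obtain ⟨p⟩ : Nonempty (Quiver.Path j i) := hle ⟨Quiver.Path.nil⟩
  exact absurd (hV j (p.cons α)) (by simp)

/-- A function on the framed quiver which strictly increases along arrows. -/
def Framed.height : Framed V → ℕ
  | .base i => {h : V | Nonempty (Quiver.Path h i)}.ncard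
  | .frozen _ => Nat.card V + 1

lemma Framed.height_le [Finite V] (a : Framed V) : a.height ≤ Nat.card V + 1 := by
  cases a with
  | base i => exact (Set.ncard_le_card _).trans (Nat.le_succ _)
  | frozen i => exact le_rfl

lemma Framed.height_lt [Finite V] (hV : IsAcyclicQuiver V) {a b : Framed V} (α : a ⟶ b) :
    a.height < b.height := by
  change Framed.Hom a b at α
  cases α with
  | arrow α => exact hV.ncard_lt α
  | frame i => exact Nat.lt_succ_of_le (Set.ncard_le_card _)

/-- An integer-valued function on the repetition quiver of the framed quiver which strictly
increases along arrows. -/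
def Repetition.height (x : Repetition (Framed V)) : ℤ :=
  x.vertex.height + (Nat.card V + 2) * x.level

lemma Repetition.height_lt [Finite V] (hV : IsAcyclicQuiver V) {x y : Repetition (Framed V)}
    (α : x ⟶ y) : x.height < y.height := by
  change Repetition.Hom x y at α
  cases α with
  | level α p => simpa [Repetition.height] using Framed.height_lt hV α
  | @sigma a b α p =>
    -- Here the level rises by one while the vertex height falls by at most `Nat.card V + 1`, which
    -- the factor `Nat.card V + 2` outweighs.
    have := Framed.height_le b
    simp only [Repetition.height, mul_sub, mul_one]
    omega

instance [Finite V] : Finite (Framed V) :=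
  Finite.of_surjective (fun i : V ⊕ V => i.elim Framed.base Framed.frozen) fun
    | .base i => ⟨.inl i, rfl⟩
    | .frozen i => ⟨.inr i, rfl⟩

instance [∀ i j : V, Finite (i ⟶ j)] (a b : Framed V) : Finite (a ⟶ b) := by
  cases a with
  | base i =>
    cases b with
    | base j =>
      exact Finite.of_surjective (fun α : i ⟶ j => (Framed.Hom.arrow α : Framed.base i ⟶ .base j))
        fun | .arrow α => ⟨α, rfl⟩
    | frozen j =>
      have : Subsingleton (Framed.base i ⟶ .frozen j) :=
        ⟨fun | .frame _, .frame _ => rfl⟩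
      infer_instance
  | frozen i =>
    have : IsEmpty (Framed.frozen i ⟶ b) := ⟨fun α => nomatch α⟩
    infer_instance

instance {W : Type u} [Quiver.{u} W] [Finite W] [∀ a b : W, Finite (a ⟶ b)] (y : Repetition W) :
    Finite (Σ x : Repetition W, (x ⟶ y)) := by
  obtain ⟨b, p⟩ := y
  refine Finite.of_surjective (α := (Σ a : W, (a ⟶ b)) ⊕ (Σ a : W, (b ⟶ a)))
    (Sum.elim (fun α => ⟨_, .level α.2 p⟩) (fun α => ⟨_, .sigma α.2 p⟩)) ?_
  rintro ⟨x, α⟩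
  change Repetition.Hom x _ at α
  cases α with
  | level α p => exact ⟨.inl ⟨_, α⟩, rfl⟩
  | sigma α p => exact ⟨.inr ⟨_, α⟩, rfl⟩

lemma finite_path [Finite V] [∀ i j : V, Finite (i ⟶ j)] (hV : IsAcyclicQuiver V)
    (x y : Repetition (Framed V)) : Finite (Quiver.Path x y) :=
  finite_path_of_strictMono Repetition.height (Repetition.height_lt hV) x y

variable (k : Type u) [Field k]

lemma finite_hom_linearQuotient {D : Type u} [Category.{u} D] [Preadditive D] [Linear k D]
    (W : MorphismProperty D) (h : ∀ x y : D, Module.Finite k (x ⟶ y)) (x y : LinearQuotient k W) :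
    Module.Finite k (x ⟶ y) := by
  have := h x.as y.as
  let l : (x.as ⟶ y.as) →ₗ[k] (x ⟶ y) :=
    { toFun := fun f => (Quotient.functor (idealRel k W)).map f
      map_add' := fun f g => rfl
      map_smul' := fun c f => rfl }
  exact Module.Finite.of_surjective l (Quotient.functor (idealRel k W)).map_surjective

/-- `R_C` is obtained from the path category by two successive linear quotients, and the paths form
a basis of the morphism spaces of the path category. -/
lemma finite_hom_RC [Finite V] [∀ i j : V, Finite (i ⟶ j)] (hV : IsAcyclicQuiver V)
    (C : Set (Repetition V)) (x y : RC k C) : Module.Finite k (x ⟶ y) := by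
  refine finite_hom_linearQuotient k _ (finite_hom_linearQuotient k _ fun x y => ?_) x y
  have : Finite (Quiver.Path (V := Repetition (Framed V)) x y) := finite_path hV _ _
  exact inferInstanceAs (Module.Finite k (Quiver.Path (V := Repetition (Framed V)) x y →₀ k))

end Quiver

/-! ### Intermediate extensions -/

section Kan

variable {k : Type u} [Field k] {R : Type u} [Category.{u} R] [Preadditive R] [Linear k R]
  {S : Type u} [Category.{u} S] [Preadditive S] [Linear k S]
  (ι : S ⥤ R) [ι.Additive] [ι.Linear k] [ι.Full] [ι.Faithful]

-- Pure tensors span the direct sum. This is the form in which images of `K_L` are controlled below.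
variable {ι} in
lemma KLSum.mk_mem_induction {M : Sᵒᵖ ⥤ ModuleCat.{u} k} {x : R} {N : Type*} [AddCommGroup N]
    [Module k N] (l : KLSum ι M x →ₗ[k] N) (T : Submodule k N)
    (h : ∀ s f m, l (KLSum.mk ι M x s f m) ∈ T) (z : KLSum ι M x) : l z ∈ T := by
  have : T.mkQ ∘ₗ l = 0 := KLSum.hom_ext ι fun s f m => by
    simpa using h s f m
  simpa using congr($this z)

/-- The image of `can` at `x` lies in the sum of the images of `R(x, ι s) ⊗ M(s)`. Only the finitely
many `s` in the support of `M` contribute, each by a finite-dimensional space. -/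
lemma finite_KLR (hR : ∀ x y : R, Module.Finite k (x ⟶ y)) (M : Sᵒᵖ ⥤ ModuleCat.{u} k)
    [IsLinearModule M] (hM : IsFiniteDimensional M) (x : R) :
    Module.Finite k ((KLR ι M).obj (op x)) := by
  classical
  have hfin := hM.1
  have hsupp := hM.2.to_subtype
  let T : Submodule k (KRObj ι M x) :=
    ⨆ s : {s : S | Nontrivial (M.obj (op s))}, LinearMap.range (canAux ι M x s.1)
  let N : Submodule k (KRObj ι M x) := (SubMod.range (can ι M)).obj x
  have hle : N ≤ T := by
    intro φ hφ
    obtain ⟨z, rfl⟩ := mem_range_can ι |>.1 hφ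
    refine KLSum.mk_mem_induction (canSum ι M x) T (fun s f m => ?_) z
    rw [canSum_mk]
    by_cases hs : Nontrivial (M.obj (op s))
    · exact Submodule.mem_iSup_of_mem (p := fun s : {s : S | Nontrivial (M.obj (op s))} =>
        LinearMap.range (canAux ι M x s.1)) ⟨s, hs⟩ ⟨_, rfl⟩
    · have := not_nontrivial_iff_subsingleton.1 hs
      rw [Subsingleton.elim m 0, tmul_zero, map_zero]
      exact T.zero_mem
  have hT : FiniteDimensional k T := Submodule.finiteDimensional_iSup _
  exact (Submodule.finiteDimensional_of_le hle : FiniteDimensional k N)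

variable {ι} {M : Sᵒᵖ ⥤ ModuleCat.{u} k} [IsLinearModule M]

/-- Evaluation at the identity commutes with the maps induced by `U ⊆ M`. This lemma and the next
are the two halves of the identification of `res K_LR(U)` with `U`. -/
lemma mem_KLRSub_KLREval_symm (U : SubMod M) (s : S) {m : M.obj (op s)} (hm : m ∈ U.obj s) :
    (KLREval ι M s).symm m ∈ (KLRSub ι U).obj (ι.obj s) := by
  refine ⟨(KLREval ι U.toModule s).symm ⟨m, hm⟩, (KLREval ι M s).injective ?_⟩
  rw [LinearEquiv.apply_symm_apply]
  exact congr(Subtype.val $((KLREval ι U.toModule s).apply_symm_apply ⟨m, hm⟩))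

lemma KLREval_mem_of_mem_KLRSub (U : SubMod M) (s : S) {φ : (KLR ι M).obj (op (ι.obj s))}
    (hφ : φ ∈ (KLRSub ι U).obj (ι.obj s)) : KLREval ι M s φ ∈ U.obj s := by
  obtain ⟨ψ, rfl⟩ := hφ
  exact (KLREval ι U.toModule s ψ).2

/-- The submodule `K_LR U` of `K_LR M` is generated by `U`. -/
lemma KLRSub_obj_le (U : SubMod M) (x : R) (T : Submodule k ((KLR ι M).obj (op x)))
    (h : ∀ (s : S) (f : x ⟶ ι.obj s), ∀ m ∈ U.obj s,
      ((KLR ι M).map f.op).hom ((KLREval ι M s).symm m) ∈ T) : (KLRSub ι U).obj x ≤ T := by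
  rintro _ ⟨⟨ψ, hψ⟩, rfl⟩
  obtain ⟨z, rfl⟩ := mem_range_can ι |>.1 hψ
  let l : KLSum ι U.toModule x →ₗ[k] (KLR ι M).obj (op x) :=
    ((KLRMap ι U.incl).app (op x)).hom ∘ₗ (canSum ι U.toModule x).codRestrict _
      fun z => (mem_range_can ι).2 ⟨z, rfl⟩
  refine KLSum.mk_mem_induction l T (fun s f m => ?_) z
  convert h s f m.1 m.2
  apply Subtype.ext
  -- The element of `K_LR(M)(ι s)` corresponding to `m` is the image of `𝟙 ⊗ m`; acting on it by `f`
  -- gives the image of `f ⊗ m`, which is what the generator of `K_L(U)` maps to.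
  have e : (KLREval ι M s).symm m.1 =
      ⟨canAux ι M (ι.obj s) s (𝟙 _ ⊗ₜ m.1),
        (mem_range_can ι).2 ⟨KLSum.mk ι M _ s (𝟙 _) m.1, canSum_mk ι M _ s _ m.1⟩⟩ := by
    refine (LinearEquiv.symm_apply_eq _).2 ?_
    change _ = (canAux ι M (ι.obj s) s (𝟙 _ ⊗ₜ m.1)).1 s (𝟙 _)
    rw [canAux_apply]
    simp
  rw [e]
  apply Subtype.ext; funext t; ext g
  change ((canSum ι U.toModule x (KLSum.mk ι U.toModule x s f m)).1 t g).1 =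
    (canAux ι M (ι.obj s) s (𝟙 _ ⊗ₜ m.1)).1 t (g ≫ f)
  rw [canSum_mk, canAux_apply, canAux_apply, Category.comp_id]
  rfl

lemma KLRSub_obj_incl (U : SubMod M) (s : S) :
    (KLRSub ι U).obj (ι.obj s) = (U.obj s).comap (KLREval ι M s).toLinearMap := by
  refine le_antisymm (fun φ => KLREval_mem_of_mem_KLRSub U s) fun φ hφ => ?_
  simpa using mem_KLRSub_KLREval_symm (ι := ι) U s hφ

lemma resSub_obj (W : SubMod (KLR ι M)) (s : S) :
    (resSub ι W).obj s = (W.obj (ι.obj s)).map (KLREval ι M s).toLinearMap := rfl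

/-- No dimension hypothesis enters: `K_LR(U)` is generated by `U`, and `W` is stable under all
morphisms. -/
lemma KLRSub_le_of_le_resSub {U : SubMod M} {W : SubMod (KLR ι M)}
    (h : ∀ s, U.obj s ≤ (resSub ι W).obj s) : KLRSub ι U ≤ W := by
  intro x
  refine KLRSub_obj_le U x _ fun s f m hm => W.map_mem f ?_
  obtain ⟨φ, hφ, rfl⟩ := h s hm
  rw [SetLike.mem_coe] at hφ
  exact ((KLREval ι M s).symm_apply_apply φ).symm ▸ hφ

lemma le_resSub_of_KLRSub_le {U : SubMod M} {W : SubMod (KLR ι M)} (h : KLRSub ι U ≤ W) (s : S) :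
    U.obj s ≤ (resSub ι W).obj s := fun m hm =>
  ⟨_, h (ι.obj s) (mem_KLRSub_KLREval_symm U s hm), (KLREval ι M s).apply_symm_apply m⟩

/-- A submodule `W` of `K_LR M` whose restriction has the same dimension vector as `U ⊆ M`
restricts to `U` if and only if it contains `K_LR U`. -/
lemma resSub_eq_iff (hM : ∀ s, Module.Finite k (M.obj (op s))) (U : SubMod M)
    (W : SubMod (KLR ι M))
    (hW : ∀ s, Module.finrank k (W.obj (ι.obj s)) = Module.finrank k (U.obj s)) :
    resSub ι W = U ↔ KLRSub ι U ≤ W := by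
  refine ⟨fun h => KLRSub_le_of_le_resSub fun s => h ▸ le_rfl, fun h => ?_⟩
  refine SubMod.ext (funext fun s => ?_)
  have := hM s
  -- Containment of `K_LR(U)` only yields `U ⊆ res W`; the equality of dimensions turns this into an
  -- equality.
  refine (Submodule.eq_of_le_of_finrank_eq (le_resSub_of_KLRSub_le h s) ?_).symm
  rw [resSub_obj, LinearEquiv.finrank_map_eq, hW]

lemma finrank_KLRSub (U : SubMod M) (x : R) :
    Module.finrank k ((KLRSub ι U).obj x) = dimVector (KLR ι U.toModule) x :=
  LinearMap.finrank_range_of_inj (KLRMap_incl_injective ι U x)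

end Kan

/-! ### Subbundles containing a given constant subbundle -/

section Subbundle

variable {k : Type u} [Field k] {A : Type u} [CommRing A] [Algebra k A] {E : Type u}
  [AddCommGroup E] [Module k E]

lemma IsSubbundle.projective {N : Submodule A (A ⊗[k] E)} {r : ℤ} (h : IsSubbundle N r) :
    Module.Projective A N := by
  obtain ⟨N', hN'⟩ := h.isComplemented
  exact Module.Projective.of_split N.subtype (N.projectionOnto N' hN')
    (LinearMap.ext fun x => Submodule.projectionOnto_apply_left hN' x)

/-- Right exactness of the tensor product. -/
lemma ker_baseChange_mkQ (P : Submodule k E) :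
    LinearMap.ker (P.mkQ.baseChange A) = P.baseChange A := by
  have h := lTensor_exact A (f := P.subtype) (g := P.mkQ)
    (LinearMap.exact_subtype_mkQ P) P.mkQ_surjective
  ext z
  exact h z

lemma baseChange_mkQ_surjective (P : Submodule k E) :
    Function.Surjective (P.mkQ.baseChange A) :=
  LinearMap.lTensor_surjective A P.mkQ_surjective

/-- The base change of a subspace is the base change of the corresponding vector space. -/
def baseChangeEquiv (P : Submodule k E) : A ⊗[k] P ≃ₗ[A] P.baseChange A :=
  (LinearEquiv.ofInjective (P.subtype.baseChange A)
    (Module.Flat.lTensor_preserves_injective_linearMap (M := A) P.subtype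
      P.injective_subtype)).trans (LinearEquiv.ofEq _ _ rfl)

variable {P : Submodule k E}

/-- A complement of the preimage is carried to a complement by `g`. Conversely, projectivity of `G`
gives a section of `g`, and a complement of `N` is transported along it. -/
lemma exists_isCompl_comap_iff {F G : Type*} [AddCommGroup F] [Module A F] [AddCommGroup G]
    [Module A G] [Module.Projective A G] (g : F →ₗ[A] G) (hg : Function.Surjective g)
    (N : Submodule A G) :
    (∃ N', IsCompl (N.comap g) N') ↔ ∃ N', IsCompl N N' := by
  constructor
  · rintro ⟨N', hN'⟩
    refine ⟨N'.map g, Submodule.disjoint_def.2 ?_, Submodule.codisjoint_iff_exists_add_eq.2 ?_⟩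
    · rintro _ hn ⟨n, hn', rfl⟩
      rw [Submodule.disjoint_def.1 hN'.disjoint n hn hn', map_zero]
    · intro z
      obtain ⟨z, rfl⟩ := hg z
      obtain ⟨a, b, ha, hb, rfl⟩ := Submodule.codisjoint_iff_exists_add_eq.1 hN'.codisjoint z
      exact ⟨g a, g b, ha, Submodule.mem_map_of_mem hb, (map_add g a b).symm⟩
  · rintro ⟨N', hN'⟩
    obtain ⟨s, hs⟩ := Module.projective_lifting_property g LinearMap.id hg
    have hs (z : G) : g (s z) = z := congr($hs z)
    refine ⟨N'.map s, Submodule.disjoint_def.2 ?_, Submodule.codisjoint_iff_exists_add_eq.2 ?_⟩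
    · rintro _ hn ⟨n, hn', rfl⟩
      rw [Submodule.mem_comap, hs] at hn
      rw [Submodule.disjoint_def.1 hN'.disjoint n hn hn', map_zero]
    · intro z
      obtain ⟨a, b, ha, hb, h⟩ :=
        Submodule.codisjoint_iff_exists_add_eq.1 hN'.codisjoint (g z)
      refine ⟨z - s b, s b, ?_, Submodule.mem_map_of_mem hb, sub_add_cancel _ _⟩
      rwa [Submodule.mem_comap, map_sub, hs, ← h, add_sub_cancel_right]

/-- The sequence `0 → ker g → g⁻¹(N) → N → 0` is exact, and it splits because `N` is projective. -/
lemma nonempty_comap_equiv_prod {F G : Type*} [AddCommGroup F] [Module A F] [AddCommGroup G]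
    [Module A G] (g : F →ₗ[A] G) (hg : Function.Surjective g) (N : Submodule A G)
    [Module.Projective A N] : Nonempty (N.comap g ≃ₗ[A] LinearMap.ker g × N) := by
  let q : N.comap g →ₗ[A] N := g.restrict fun _ h => h
  have hq : Function.Surjective q := fun ⟨n, hn⟩ => by
    obtain ⟨z, rfl⟩ := hg n
    exact ⟨⟨z, hn⟩, rfl⟩
  have hle : LinearMap.ker g ≤ N.comap g := fun z hz => by
    rw [Submodule.mem_comap, LinearMap.mem_ker.1 hz]
    exact N.zero_mem
  obtain ⟨s, hs⟩ := Module.projective_lifting_property q LinearMap.id hq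
  have hex : Function.Exact (Submodule.inclusion hle) q := fun z => by
    constructor
    · intro hz
      exact ⟨⟨z.1, congr(Subtype.val $hz)⟩, rfl⟩
    · rintro ⟨y, rfl⟩
      exact Subtype.ext y.2
  exact ⟨(hex.splitSurjectiveEquiv (Submodule.inclusion_injective hle) ⟨s, hs⟩).1⟩

/-- The subbundles of `A ⊗ E` containing `A ⊗ P` correspond to those of `A ⊗ (E / P)`. -/
lemma isSubbundle_comap_iff [Module.Finite k P] (N : Submodule A (A ⊗[k] (E ⧸ P))) (r : ℤ) :
    IsSubbundle (N.comap (P.mkQ.baseChange A)) r ↔ IsSubbundle N (r - Module.finrank k P) := by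
  have hg := baseChange_mkQ_surjective (A := A) P
  have hc := exists_isCompl_comap_iff (P.mkQ.baseChange A) hg N
  -- Finiteness and rank are compared through a splitting, which needs `N` projective, hence a
  -- complement of `N`. Without one, both sides fail.
  by_cases hN : ∃ N', IsCompl N N'
  swap
  · exact ⟨fun h => absurd (hc.1 h.1) hN, fun h => absurd h.1 hN⟩
  obtain ⟨N', hN'⟩ := id hN
  have : Module.Projective A N := Module.Projective.of_split N.subtype (N.projectionOnto N' hN')
    (LinearMap.ext fun x => Submodule.projectionOnto_apply_left hN' x)
  obtain ⟨e⟩ := nonempty_comap_equiv_prod (P.mkQ.baseChange A) hg N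
  let e' : N.comap (P.mkQ.baseChange A) ≃ₗ[A] (A ⊗[k] P) × N :=
    e.trans (((LinearEquiv.ofEq _ _ (ker_baseChange_mkQ P)).trans
      (baseChangeEquiv P).symm).prodCongr (LinearEquiv.refl A N))
  have hfin : Module.Finite A (N.comap (P.mkQ.baseChange A)) ↔ Module.Finite A N := by
    constructor
    · intro h
      exact Module.Finite.of_surjective (LinearMap.snd A (A ⊗[k] P) N ∘ₗ e'.toLinearMap)
        (Prod.snd_surjective.comp e'.surjective)
    · intro h
      exact Module.Finite.equiv e'.symm
  have hrank [Module.Finite A N] (p : PrimeSpectrum A) :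
      Module.rankAtStalk (R := A) (N.comap (P.mkQ.baseChange A)) p =
        Module.finrank k P + Module.rankAtStalk (R := A) N p := by
    -- The rank of the free module `A ⊗ P` equals `dim P` only for nontrivial `A`; the existence of
    -- a prime ensures this.
    have := p.nontrivial
    have h₁ : Module.rankAtStalk (R := A) (N.comap (P.mkQ.baseChange A)) p = _ :=
      congr_fun (Module.rankAtStalk_eq_of_equiv (N := (A ⊗[k] P) × N) e') p
    rw [h₁, Module.rankAtStalk_prod, Pi.add_apply, Module.rankAtStalk_eq_finrank_of_free,
      Pi.natCast_apply, Module.finrank_baseChange]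
    rfl
  constructor
  · rintro ⟨-, h, hr⟩
    have := hfin.1 h
    refine ⟨hN, this, fun p => ?_⟩
    rw [← hr p, hrank p]
    push_cast
    ring
  · rintro ⟨-, h, hr⟩
    refine ⟨hc.2 hN, hfin.2 h, fun p => ?_⟩
    rw [hrank p]
    push_cast
    rw [hr p]
    ring

/-- A finitely generated projective module whose rank is zero at every prime is zero. -/
lemma IsSubbundle.eq_bot {N : Submodule A (A ⊗[k] E)} (h : IsSubbundle N 0) : N = ⊥ := by
  have := h.projective
  have := h.finite
  have hN : Module.rankAtStalk (R := A) N = 0 := funext fun p => by exact_mod_cast h.rank_eq p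
  exact (Submodule.subsingleton_iff_eq_bot).1 (Module.rankAtStalk_eq_zero_iff_subsingleton.1 hN)

end Subbundle

/-! ### The fibres of the restriction morphism -/

section Points

variable {k : Type u} [Field k] {A B : Type u} [CommRing A] [Algebra k A] [CommRing B]
  [Algebra k B] {E : Type u} [AddCommGroup E] [Module k E]

/-- Both sides are spanned by the elements `1 ⊗ m`. Thus the `A`-point induced by the `k`-point `U`
is `A ⊗ U`. -/
lemma pullSub_baseChange (f : A →ₐ[k] B) (P : Submodule k E) :
    pullSub f (P.baseChange A) = P.baseChange B := by
  rw [Submodule.baseChange_eq_span, pullSub_span, Submodule.baseChange_eq_span]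
  congr 1
  rw [Submodule.map_coe, Submodule.map_coe, Set.image_image]
  exact Set.image_congr fun m _ => by simp

lemma map_baseChange {E' : Type u} [AddCommGroup E'] [Module k E'] (l : E →ₗ[k] E')
    (P : Submodule k E) : (P.baseChange A).map (l.baseChange A) = (P.map l).baseChange A := by
  rw [Submodule.baseChange_eq_span, Submodule.baseChange_eq_span, Submodule.map_span]
  simp only [Submodule.map_coe, Set.image_image]
  congr 1

lemma baseChange_le_iff (P : Submodule k E) (N : Submodule A (A ⊗[k] E)) :
    P.baseChange A ≤ N ↔ ∀ m ∈ P, (1 : A) ⊗ₜ[k] m ∈ N := by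
  rw [Submodule.baseChange_eq_span, Submodule.span_le]
  exact Set.image_subset_iff

variable {R : Type u} [Category.{u} R] {F : Rᵒᵖ ⥤ ModuleCat.{u} k}

/-- The projection onto the quotient by a submodule. -/
def SubMod.mkQ (U : SubMod F) (x : R) : F.obj (op x) →ₗ[k] U.quotient.obj (op x) :=
  (U.obj x).mkQ

lemma SubMod.mkQ_map_baseChange (U : SubMod F) {x y : R} (f : x ⟶ y)
    (m : A ⊗[k] F.obj (op y)) :
    (U.mkQ x).baseChange A ((F.map f.op).hom.baseChange A m) =
      (U.quotient.map f.op).hom.baseChange A ((U.mkQ y).baseChange A m) := by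
  have h : U.mkQ x ∘ₗ (F.map f.op).hom = (U.quotient.map f.op).hom ∘ₗ U.mkQ y := rfl
  rw [← LinearMap.comp_apply, ← LinearMap.baseChange_comp, h, LinearMap.baseChange_comp]
  rfl

lemma SubMod.ker_mkQ_baseChange (U : SubMod F) (x : R) :
    LinearMap.ker ((U.mkQ x).baseChange A) = (U.obj x).baseChange A :=
  ker_baseChange_mkQ _

lemma SubMod.mkQ_baseChange_surjective (U : SubMod F) (x : R) :
    Function.Surjective ((U.mkQ x).baseChange A) :=
  baseChange_mkQ_surjective _

lemma SubMod.comap_map_mkQ (U : SubMod F) {x : R} {N : Submodule A (A ⊗[k] F.obj (op x))}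
    (h : (U.obj x).baseChange A ≤ N) :
    (N.map ((U.mkQ x).baseChange A)).comap ((U.mkQ x).baseChange A) = N := by
  rw [Submodule.comap_map_eq, U.ker_mkQ_baseChange, sup_eq_left.2 h]

/-- The points of the quiver Grassmannian of `F` containing a submodule `U` of `F` are those of the
quiver Grassmannian of `F / U`. -/
def GrPoint.quotientEquiv (U : SubMod F) (hU : ∀ x, Module.Finite k (U.obj x)) {e d : R → ℤ}
    (hd : ∀ x, d x = e x - Module.finrank k (U.obj x)) (A : Type u) [CommRing A] [Algebra k A] :
    {W : GrPoint F e A // ∀ x, (U.obj x).baseChange A ≤ W.obj x} ≃ GrPoint U.quotient d A where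
  toFun W :=
    { obj := fun x => (W.1.obj x).map ((U.mkQ x).baseChange A)
      map_mem := by
        rintro x y f _ ⟨m, hm, rfl⟩
        exact ⟨_, W.1.map_mem f hm, U.mkQ_map_baseChange f m⟩
      isSubbundle := fun x => by
        have := hU x
        rw [hd]
        refine (isSubbundle_comap_iff (P := U.obj x) _ _).1 ?_
        have h := U.comap_map_mkQ (W.2 x)
        exact h.symm ▸ W.1.isSubbundle x }
  invFun N := ⟨
    { obj := fun x => (N.obj x).comap ((U.mkQ x).baseChange A)
      map_mem := fun {x y} f m hm => by
        rw [Submodule.mem_comap, U.mkQ_map_baseChange]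
        exact N.map_mem f hm
      isSubbundle := fun x => by
        have := hU x
        exact (isSubbundle_comap_iff (P := U.obj x) _ _).2 (hd x ▸ N.isSubbundle x) },
    fun x => by
      rw [← U.ker_mkQ_baseChange]
      exact fun z hz => by
        rw [Submodule.mem_comap, LinearMap.mem_ker.1 hz]
        exact (N.obj x).zero_mem⟩
  left_inv W := Subtype.ext (GrPoint.ext (funext fun x => U.comap_map_mkQ (W.2 x)))
  right_inv N := GrPoint.ext (funext fun x =>
    Submodule.map_comap_eq_of_surjective (U.mkQ_baseChange_surjective x) _)

end Points

section Fibre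

variable {k : Type u} [Field k] {R : Type u} [Category.{u} R] [Preadditive R] [Linear k R]
  {S : Type u} [Category.{u} S] [Preadditive S] [Linear k S]
  {ι : S ⥤ R} [ι.Additive] [ι.Linear k] [ι.Full] [ι.Faithful]
  {M : Sᵒᵖ ⥤ ModuleCat.{u} k} [IsLinearModule M]

/-- A point of the quiver Grassmannian of `K_LR M` of the rank of `U` on `S` restricts to `U` if
and only if it contains `K_LR U`. -/
lemma map_KLREval_eq_iff (U : SubMod M) (hfin : ∀ x, Module.Finite k ((KLR ι M).obj (op x)))
    {e : R → ℤ} (he : ∀ s, e (ι.obj s) = Module.finrank k (U.obj s)) {A : Type u} [CommRing A]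
    [Algebra k A] (W : GrPoint (KLR ι M) e A) :
    (∀ s, (W.obj (ι.obj s)).map ((KLREval ι M s).toLinearMap.baseChange A) =
      (U.obj s).baseChange A) ↔ ∀ x, ((KLRSub ι U).obj x).baseChange A ≤ W.obj x := by
  have hmap (s : S) : (((KLRSub ι U).obj (ι.obj s)).baseChange A).map
      ((KLREval ι M s).toLinearMap.baseChange A) = (U.obj s).baseChange A := by
    rw [map_baseChange, KLRSub_obj_incl,
      Submodule.map_comap_eq_of_surjective (KLREval ι M s).surjective]
  constructor
  · intro h x
    rw [baseChange_le_iff]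
    -- The `φ` with `1 ⊗ φ ∈ W(x)` form a `k`-subspace, so generation of `K_LR(U)` by `U` over `k`
    -- suffices for arbitrary `A`.
    refine KLRSub_obj_le U x (((W.obj x).restrictScalars k).comap (TensorProduct.mk k A _ 1))
      fun s f m hm => ?_
    refine W.map_mem f (m := 1 ⊗ₜ (KLREval ι M s).symm m) ?_
    have hm' : (1 : A) ⊗ₜ[k] m ∈
        (W.obj (ι.obj s)).map ((KLREval ι M s).toLinearMap.baseChange A) := by
      rw [h s]
      exact Submodule.tmul_mem_baseChange_of_mem 1 hm
    obtain ⟨z, hz, hzm⟩ := hm'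
    have hinj : Function.Injective ((KLREval ι M s).toLinearMap.baseChange A) :=
      ((KLREval ι M s).baseChange k A _ _).injective
    have hz' : z = 1 ⊗ₜ (KLREval ι M s).symm m := hinj (by
      rw [hzm, LinearMap.baseChange_tmul]
      exact congr((1 : A) ⊗ₜ[k] $(((KLREval ι M s).apply_symm_apply m).symm)))
    exact hz' ▸ hz
  · intro h s
    rw [← hmap s]
    congr 1
    have hW := (KLRSub ι U).comap_map_mkQ (h (ι.obj s))
    have hK := hfin (ι.obj s)
    -- At `ι s` the ranks of `W` and `A ⊗ K_LR(U)` agree, so the quotient of the former by the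
    -- latter is a subbundle of rank zero and vanishes. This replaces the dimension count over a
    -- field.
    have hsub : IsSubbundle ((W.obj (ι.obj s)).map
        (((KLRSub ι U).obj (ι.obj s)).mkQ.baseChange A)) 0 := by
      have h0 : e (ι.obj s) - Module.finrank k ((KLRSub ι U).obj (ι.obj s)) = 0 := by
        rw [he, KLRSub_obj_incl, sub_eq_zero, ← LinearEquiv.finrank_map_eq (KLREval ι M s),
          Submodule.map_comap_eq_of_surjective (KLREval ι M s).surjective]
      rw [← h0]
      refine (isSubbundle_comap_iff (P := (KLRSub ι U).obj (ι.obj s)) _ _).1 ?_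
      exact hW.symm ▸ W.isSubbundle (ι.obj s)
    rw [← hW, ← (KLRSub ι U).ker_mkQ_baseChange]
    change Submodule.comap _ (Submodule.map
      (((KLRSub ι U).obj (ι.obj s)).mkQ.baseChange A) _) = _
    rw [hsub.eq_bot]
    rfl

/-- The fibre over `U` of the restriction morphism from the quiver Grassmannian of `K_LR M` is the
quiver Grassmannian of `K_LR M / K_LR U`. -/
def fibreIso (hM : IsFiniteDimensional M)
    (hfin : ∀ x, Module.Finite k ((KLR ι M).obj (op x))) (U : SubMod M) {w : S → ℕ}
    (hU : ∀ s, Module.finrank k (U.obj s) = w s) {e d : R → ℤ}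
    (he : ∀ s, e (ι.obj s) = w s)
    (hd : ∀ x, d x = e x - Module.finrank k ((KLRSub ι U).obj x)) :
    fibre (resGr ι M e (fun s => (w s : ℤ)) he) (U.toPoint hM hU) ≅
      Gr (KLRSub ι U).quotient d :=
  NatIso.ofComponents
    (fun A => Equiv.toIso <| (Equiv.subtypeEquivRight fun W => by
      refine Iff.trans ?_ (map_KLREval_eq_iff U hfin (fun s => by rw [he, hU]) W)
      refine GrPoint.ext_iff.trans (funext_iff.trans (forall_congr' fun s => ?_))
      exact Eq.congr_right (pullSub_baseChange _ (U.obj s))).trans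
        (GrPoint.quotientEquiv (KLRSub ι U) (fun x => have := hfin x; inferInstance) hd A))
    -- Naturality: pulling back along `f` commutes with taking images under the base change of a
    -- `k`-linear map, here the projection to the quotient.
    (fun {A B} f => by
      apply ConcreteCategory.hom_ext; intro W
      exact GrPoint.ext (funext fun x => pullSub_map f.hom _ (W.1.obj x)))

end Fibre

end Nakajima

end

open Nakajima
theorem theorem3p6 {k : Type u} [Field k]
    {V : Type u} [Quiver.{u} V] [Finite V] [∀ i j : V, Finite (i ⟶ j)] (hV : IsAcyclicQuiver V)
    (C : Set (Repetition V))
    (M : (SC k C)ᵒᵖ ⥤ ModuleCat.{u} k) [IsLinearModule M] (hM : IsFiniteDimensional M)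
    (v : Repetition V → ℕ) (w : SC k C → ℕ)
    (U : SubMod M) (hU : ∀ s, Module.finrank k (U.obj s) = w s) :
    -- the spaces `K_LR(M)(x)` are finite-dimensional, so that dimension vectors make sense
    (∀ x, Module.Finite k ((KLR (inclSC k C) M).obj (op x))) ∧
    -- for a submodule of `K_LR(M)` of dimension vector `(v, w)`
    (∀ W : SubMod (KLR (inclSC k C) M),
      (∀ x, Module.finrank k (W.obj x) = dimVec k v w x) →
        (resSub (inclSC k C) W = U ↔ KLRSub (inclSC k C) U ≤ W)) ∧
    -- the fibre of `Gr_(v,w)(K_LR M) ⟶ Gr_w(M)` over `U`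
    Nonempty
      (fibre
          (resGr (inclSC k C) M (fun x => (dimVec k v w x : ℤ)) (fun s => (w s : ℤ))
            (fun s => congrArg Nat.cast (dimVec_incl k v w s)))
          (U.toPoint hM hU) ≅
        Gr (KLRSub (inclSC k C) U).quotient
          (fun x => (dimVec k v w x : ℤ) - (dimVector (KLR (inclSC k C) U.toModule) x : ℤ))) := by
  have hfin := finite_KLR (inclSC k C) (finite_hom_RC k hV C) M hM
  refine ⟨hfin, fun W hW => resSub_eq_iff hM.1 U W fun s => ?_, ⟨fibreIso hM hfin U hU _ ?_⟩⟩
  · rw [hW, dimVec_incl, hU]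
  -- `K_LR(U)` as a module and as a submodule of `K_LR(M)` have the same dimensions, since `K_LR`
  -- preserves the injectivity of `U ⊆ M`.
  · exact fun x => by rw [finrank_KLRSub]
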